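/- A residuated lattice is an algebra $\mathbf{A}=(A,\wedge,\vee,\cdot,\backslash,/,1)$ such that $(A,\wedge,\vee)$ is a lattice, $(A,\cdot,1)$ is a monoid, and $y\le x\backslash z \iff x\cdot y\le z \iff x\le z/y$ for all $x,y,z\in A$. Write $x^r=x\backslash 1$, $x^\ell=1/x$ and $x^\star=x^\ell\wedge x^r$. A $^\star$-involutive idempotent residuated chain is a residuated lattice that is totally ordered and satisfies $x\cdot x=x$ and $x^{\star\star}=x$ for all $x$. An embedding is an injective map that preserves all the operations $\wedge,\vee,\cdot,\backslash,/,1$. Theorem. The class of $^\star$-involutive idempotent residuated chains has the strong amalgamation property: for all $^\star$-involutive idempotent residuated chains $\mathbf{A},\mathbf{B},\mathbf{C}$ and all embeddings $f_B\colon\mathbf{A}\to\mathbf{B}$ and $f_C\colon\mathbf{A}\to\mathbf{C}$, there exist a $^\star$-involutive idempotent residuated chain $\mathbf{D}$ and embeddings $g_B\colon\mathbf{B}\to\mathbf{D}$ and $g_C\colon\mathbf{C}\to\mathbf{D}$ such that $g_B\circ f_B=g_C\circ f_C$ and $(g_B\circ f_B)[A]=g_B[B]\cap g_C[C]$. -/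

import Mathlib

universe u v

/-- A residuated lattice `(A, ⊓, ⊔, *, ldiv, rdiv, 1)`. Here `ldiv x z` is the left division
`x \ z` and `rdiv z y` is the right division `z / y`. -/
class ResiduatedLattice (α : Type u) extends Lattice α, Monoid α where
  /-- Left division `x \ z`. -/
  ldiv : α → α → α
  /-- Right division `z / y`. -/
  rdiv : α → α → α
  /-- `y ≤ x \ z` iff `x * y ≤ z`. -/
  le_ldiv_iff : ∀ x y z : α, y ≤ ldiv x z ↔ x * y ≤ z
  /-- `x ≤ z / y` iff `x * y ≤ z`. -/
  le_rdiv_iff : ∀ x y z : α, x ≤ rdiv z y ↔ x * y ≤ z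

namespace ResiduatedLattice

/-- The right inverse `xʳ = x \ 1`. -/
def rinv {α : Type u} [ResiduatedLattice α] (x : α) : α := ldiv x 1

/-- The left inverse `xˡ = 1 / x`. -/
def linv {α : Type u} [ResiduatedLattice α] (x : α) : α := rdiv 1 x

/-- The operation `x⋆ = xˡ ⊓ xʳ`. -/
def starInv {α : Type u} [ResiduatedLattice α] (x : α) : α := linv x ⊓ rinv x

/-- The class of `⋆`-involutive idempotent residuated chains: totally ordered residuated lattices
satisfying `x * x = x` and `x⋆⋆ = x`. -/
structure IsStarInvolutiveIdempotentChain (α : Type u) [ResiduatedLattice α] : Prop where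
  total : ∀ x y : α, x ≤ y ∨ y ≤ x
  idempotent : ∀ x : α, x * x = x
  starInv_starInv : ∀ x : α, starInv (starInv x) = x

/-- A map between residuated lattices is an embedding if it is injective and preserves all the
operations `⊓, ⊔, *, \, /, 1`. -/
structure IsEmbedding {α : Type u} {β : Type v} [ResiduatedLattice α] [ResiduatedLattice β]
    (f : α → β) : Prop where
  injective : Function.Injective f
  map_inf : ∀ x y : α, f (x ⊓ y) = f x ⊓ f y
  map_sup : ∀ x y : α, f (x ⊔ y) = f x ⊔ f y
  map_mul : ∀ x y : α, f (x * y) = f x * f y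
  map_ldiv : ∀ x y : α, f (ldiv x y) = ldiv (f x) (f y)
  map_rdiv : ∀ x y : α, f (rdiv x y) = rdiv (f x) (f y)
  map_one : f 1 = 1

/-- The triple `(D, gB, gC)` is a strong amalgam of the pair of maps `fB : A → B`, `fC : A → C`:
`gB` and `gC` are embeddings with `gB ∘ fB = gC ∘ fC`, and the images of `B` and `C` in `D`
intersect exactly in the image of `A`. -/
structure IsStrongAmalgam {A B C D : Type u} [ResiduatedLattice B]
    [ResiduatedLattice C] [ResiduatedLattice D]
    (fB : A → B) (fC : A → C) (gB : B → D) (gC : C → D) : Prop where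
  embedding_left : IsEmbedding gB
  embedding_right : IsEmbedding gC
  comm : gB ∘ fB = gC ∘ fC
  strong : Set.range (gB ∘ fB) = Set.range gB ∩ Set.range gC

/-- A class `K` of residuated lattices has the strong amalgamation property if every V-formation
in `K` has a strong amalgam in `K`. -/
def HasStrongAmalgamationProperty (K : ∀ (α : Type u) [ResiduatedLattice α], Prop) : Prop :=
  ∀ (A B C : Type u) [ResiduatedLattice A] [ResiduatedLattice B] [ResiduatedLattice C],
    K A → K B → K C →
    ∀ (fB : A → B) (fC : A → C), IsEmbedding fB → IsEmbedding fC →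
      ∃ (D : Type u) (_ : ResiduatedLattice D) (gB : B → D) (gC : C → D),
        K D ∧ IsStrongAmalgam fB fC gB gC

end ResiduatedLattice

/-! In a `⋆`-involutive idempotent residuated chain every product is one of its factors, and the
order, the unit and the two inverses determine all other operations (`mul_conservative`, `ldiv_eq`,
`isEmbedding_of_strictMono`). Since `⋆` reverses the order and swaps the positive and negative
elements, it remains to describe the inverses of `p⋆` for `p > 1`. Their meet is `p`, so one of them
is `p`; by associativity the other is `p` or an upper cover of `p` (`eq_of_lt_of_le_inv`). A label
on that covering pair records which inverse moves. The inverses of positive elements are then known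
too (`inv_not_inv`). Thus a chain amounts to a labelled chain of positive elements, `SignedChain`
goes back, and embeddings induce closed embeddings because labelled neighbours are given by terms.

Closed embeddings amalgamate strongly (`exists_amalgam`): merge `B` and `C` along the cuts of `A`,
with `B` below `C` inside each cut, and keep all labels. A labelled pair of `B` could be split by
`C` only if its upper end lies in `A`; closedness then puts the whole pair into `A`, and its image
in `C` is a cover. -/

set_option linter.unusedSectionVars false

/-! ### Labelled chains and closed embeddings -/

/-- A linear order in which some covering pairs carry a label, at most one each. -/
class LabelledChain (Q : Type u) extends LinearOrder Q where
  /-- `label i p q` says that the covering pair `p ⋖ q` carries the label `i`. -/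
  label : Bool → Q → Q → Prop
  covBy_of_label : ∀ {i p q}, label i p q → p ⋖ q
  label_unique : ∀ {i j p q}, label i p q → label j p q → i = j

namespace LabelledChain

section Basic

variable {Q : Type u} [LabelledChain Q]

theorem lt_of_label {i : Bool} {p q : Q} (h : label i p q) : p < q :=
  (covBy_of_label h).lt

theorem label_succ_unique {i j : Bool} {p q q' : Q} (h : label i p q) (h' : label j p q') :
    q = q' :=
  (covBy_of_label h).unique_right (covBy_of_label h')

theorem label_pred_unique {i j : Bool} {p p' q : Q} (h : label i p q) (h' : label j p' q) :
    p = p' :=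
  (covBy_of_label h).unique_left (covBy_of_label h')

open Classical in
/-- The upper neighbour of `p` along the label `i`, or `p` if there is none. -/
noncomputable def succ (i : Bool) (p : Q) : Q :=
  if h : ∃ q, label i p q then h.choose else p

open Classical in
/-- The lower neighbour of `q` along the label `i`, or `q` if there is none. -/
noncomputable def pred (i : Bool) (q : Q) : Q :=
  if h : ∃ p, label i p q then h.choose else q

theorem succ_eq_of_label {i : Bool} {p q : Q} (h : label i p q) : succ i p = q := by
  have h' : ∃ q, label i p q := ⟨q, h⟩
  rw [succ, dif_pos h']
  exact label_succ_unique h'.choose_spec h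

theorem pred_eq_of_label {i : Bool} {p q : Q} (h : label i p q) : pred i q = p := by
  have h' : ∃ p, label i p q := ⟨p, h⟩
  rw [pred, dif_pos h']
  exact label_pred_unique h'.choose_spec h

theorem succ_eq_self {i : Bool} {p : Q} (h : ∀ q, ¬ label i p q) : succ i p = p :=
  dif_neg (by simpa using h)

theorem pred_eq_self {i : Bool} {q : Q} (h : ∀ p, ¬ label i p q) : pred i q = q :=
  dif_neg (by simpa using h)

theorem le_succ_iff {i : Bool} {p q : Q} : q ≤ succ i p ↔ q ≤ p ∨ label i p q := by
  by_cases h : ∃ s, label i p s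
  · obtain ⟨s, hs⟩ := h
    rw [succ_eq_of_label hs]
    constructor
    · intro hq
      rcases hq.lt_or_eq with hq | rfl
      · exact Or.inl (not_lt.1 fun hpq => (covBy_of_label hs).2 hpq hq)
      · exact Or.inr hs
    · rintro (hq | hq)
      · exact hq.trans (lt_of_label hs).le
      · exact (label_succ_unique hq hs).le
  · rw [succ_eq_self (by simpa using h)]
    exact ⟨Or.inl, fun hq => hq.elim id fun hq => (h ⟨_, hq⟩).elim⟩

theorem pred_le_iff {i : Bool} {p q : Q} : pred i q ≤ p ↔ q ≤ p ∨ label i p q := by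
  by_cases h : ∃ s, label i s q
  · obtain ⟨s, hs⟩ := h
    rw [pred_eq_of_label hs]
    constructor
    · intro hp
      rcases hp.lt_or_eq with hp | rfl
      · exact Or.inl (not_lt.1 fun hpq => (covBy_of_label hs).2 hp hpq)
      · exact Or.inr hs
    · rintro (hp | hp)
      · exact (lt_of_label hs).le.trans hp
      · exact (label_pred_unique hs hp).le
  · rw [pred_eq_self (by simpa using h)]
    exact ⟨Or.inl, fun hq => hq.elim id fun hq => (h ⟨_, hq⟩).elim⟩

/-- A covering pair has at most one label, so at most one of the two maps moves `p`. With its dual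
this makes `⋆` involutive on signed chains. -/
theorem min_succ_succ {i j : Bool} (hij : i ≠ j) (p : Q) : min (succ i p) (succ j p) = p := by
  refine le_antisymm ?_ (le_min (le_succ_iff.2 (Or.inl le_rfl)) (le_succ_iff.2 (Or.inl le_rfl)))
  rcases le_succ_iff.1 (min_le_left (succ i p) (succ j p)) with h | h
  · exact h
  rcases le_succ_iff.1 (min_le_right (succ i p) (succ j p)) with h' | h'
  · exact h'
  exact (hij (label_unique h h')).elim

theorem max_pred_pred {i j : Bool} (hij : i ≠ j) (q : Q) : max (pred i q) (pred j q) = q := by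
  refine le_antisymm (max_le (pred_le_iff.2 (Or.inl le_rfl)) (pred_le_iff.2 (Or.inl le_rfl))) ?_
  rcases pred_le_iff.1 (le_max_left (pred i q) (pred j q)) with h | h
  · exact h
  rcases pred_le_iff.1 (le_max_right (pred i q) (pred j q)) with h' | h'
  · exact h'
  exact (hij (label_unique h h')).elim

end Basic

/-- Order embeddings that preserve labels and whose range is closed under labelled neighbours. -/
structure IsClosedEmbedding {P : Type u} {Q : Type v} [LabelledChain P] [LabelledChain Q]
    (f : P → Q) : Prop where
  strictMono : StrictMono f
  map_label : ∀ {i p q}, label i p q → label i (f p) (f q)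
  label_right : ∀ {i p s}, label i (f p) s → ∃ q, f q = s ∧ label i p q
  label_left : ∀ {i s q}, label i s (f q) → ∃ p, f p = s ∧ label i p q

namespace IsClosedEmbedding

variable {P : Type u} {Q : Type v} [LabelledChain P] [LabelledChain Q] {f : P → Q}

/-- Closedness of the range is needed when `p` has no labelled neighbour: its image must not acquire
one. -/
theorem map_succ (hf : IsClosedEmbedding f) (i : Bool) (p : P) : f (succ i p) = succ i (f p) := by
  by_cases h : ∃ q, label i p q
  · obtain ⟨q, hq⟩ := h
    rw [succ_eq_of_label hq, succ_eq_of_label (hf.map_label hq)]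
  · rw [succ_eq_self (by simpa using h), succ_eq_self]
    intro s hs
    obtain ⟨q, -, hq⟩ := hf.label_right hs
    exact h ⟨q, hq⟩

theorem map_pred (hf : IsClosedEmbedding f) (i : Bool) (q : P) : f (pred i q) = pred i (f q) := by
  by_cases h : ∃ p, label i p q
  · obtain ⟨p, hp⟩ := h
    rw [pred_eq_of_label hp, pred_eq_of_label (hf.map_label hp)]
  · rw [pred_eq_self (by simpa using h), pred_eq_self]
    intro s hs
    obtain ⟨p, -, hp⟩ := hf.label_left hs
    exact h ⟨p, hp⟩

end IsClosedEmbedding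

/-! ### Strong amalgamation of labelled chains -/

section Amalgam

variable {A B C : Type u} [LabelledChain A] [LabelledChain B] [LabelledChain C]

/-- The carrier of the amalgam of `B` and `C` over `A`. -/
inductive Amalgam (fB : A → B) (fC : A → C) : Type u
  | left (b : B) : Amalgam fB fC
  | right (c : C) (hc : ∀ a, fC a ≠ c) : Amalgam fB fC

namespace Amalgam

variable {fB : A → B} {fC : A → C}

/-- Elements of `B` and `C` that lie in the same cut of `A` are ordered with `B` below `C`. -/
protected def LE : Amalgam fB fC → Amalgam fB fC → Prop
  | left b, left b' => b ≤ b'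
  | right c _, right c' _ => c ≤ c'
  | right c _, left b => ∃ a, c ≤ fC a ∧ fB a ≤ b
  | left b, right c _ => ¬ ∃ a, c ≤ fC a ∧ fB a ≤ b

open Classical in
noncomputable instance : LinearOrder (Amalgam fB fC) where
  le := Amalgam.LE
  le_refl x := by cases x <;> exact le_rfl
  le_trans x y z hxy hyz := by
    rcases x with b | ⟨c, hc⟩ <;> rcases y with b' | ⟨c', hc'⟩ <;> rcases z with b'' | ⟨c'', hc''⟩
    · exact le_trans (α := B) hxy hyz
    · rintro ⟨a, h1, h2⟩
      exact hyz ⟨a, h1, h2.trans hxy⟩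
    · obtain ⟨a, h1, h2⟩ := hyz
      exact not_lt.1 fun h => hxy ⟨a, h1, h2.trans (le_of_lt h)⟩
    · rintro ⟨a, h1, h2⟩
      exact hxy ⟨a, le_trans hyz h1, h2⟩
    · obtain ⟨a, h1, h2⟩ := hxy
      exact ⟨a, h1, h2.trans hyz⟩
    · obtain ⟨a, h1, h2⟩ := hxy
      exact not_lt.1 fun h => hyz ⟨a, (le_of_lt h).trans h1, h2⟩
    · obtain ⟨a, h1, h2⟩ := hyz
      exact ⟨a, le_trans hxy h1, h2⟩
    · exact le_trans (α := C) hxy hyz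
  le_antisymm x y hxy hyx := by
    rcases x with b | ⟨c, hc⟩ <;> rcases y with b' | ⟨c', hc'⟩
    · exact congrArg left (le_antisymm hxy hyx)
    · exact (hxy hyx).elim
    · exact (hyx hxy).elim
    · obtain rfl : c = c' := le_antisymm hxy hyx
      rfl
  le_total x y := by
    rcases x with b | ⟨c, hc⟩ <;> rcases y with b' | ⟨c', hc'⟩
    · exact le_total b b'
    · exact (Classical.em _).symm
    · exact Classical.em _
    · exact le_total c c'
  toDecidableLE := Classical.decRel _

theorem left_le_left {b b' : B} : (left b : Amalgam fB fC) ≤ left b' ↔ b ≤ b' := Iff.rfl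

theorem right_le_right {c c' : C} {hc hc'} :
    (right c hc : Amalgam fB fC) ≤ right c' hc' ↔ c ≤ c' := Iff.rfl

theorem right_le_left {b : B} {c : C} {hc} :
    (right c hc : Amalgam fB fC) ≤ left b ↔ ∃ a, c ≤ fC a ∧ fB a ≤ b := Iff.rfl

theorem left_lt_left {b b' : B} : (left b : Amalgam fB fC) < left b' ↔ b < b' := by
  rw [← not_le, ← not_le, left_le_left]

theorem right_lt_right {c c' : C} {hc hc'} :
    (right c hc : Amalgam fB fC) < right c' hc' ↔ c < c' := by
  rw [← not_le, ← not_le, right_le_right]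

theorem left_lt_right {b : B} {c : C} {hc} :
    (left b : Amalgam fB fC) < right c hc ↔ ∀ a, c ≤ fC a → b < fB a := by
  rw [← not_le, right_le_left]
  push Not
  rfl

/-- The union of the labels of `B` and of `C`. -/
protected def label (i : Bool) : Amalgam fB fC → Amalgam fB fC → Prop
  | left b, left b' => LabelledChain.label i b b'
  | right c _, right c' _ => LabelledChain.label i c c'
  | _, _ => False

theorem covBy_of_label (hB : IsClosedEmbedding fB) (hC : IsClosedEmbedding fC) {i : Bool}
    {x y : Amalgam fB fC} (h : Amalgam.label i x y) : x ⋖ y := by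
  rcases x with b | ⟨c, hc⟩ <;> rcases y with b' | ⟨c', hc'⟩
  · have hbb : LabelledChain.label i b b' := h
    refine ⟨left_lt_left.2 (lt_of_label hbb), ?_⟩
    rintro (b'' | ⟨c, hc⟩) h1 h2
    · exact (LabelledChain.covBy_of_label hbb).2 (left_lt_left.1 h1) (left_lt_left.1 h2)
    · obtain ⟨a, hca, hab⟩ := right_le_left.1 h2.le
      have h1' := left_lt_right.1 h1
      -- The element `a` separating `c` from `b'` cannot fall strictly inside the cover, so it is
      -- the upper end. Closedness then brings the lower end into `A`.
      have ha : fB a = b' := hab.eq_of_not_lt fun hlt =>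
        (LabelledChain.covBy_of_label hbb).2 (h1' a hca) hlt
      subst ha
      obtain ⟨a', rfl, haa⟩ := hB.label_left hbb
      have hlt : fC a' < c := not_le.1 fun hle => lt_irrefl _ (h1' a' hle)
      exact (LabelledChain.covBy_of_label (hC.map_label haa)).2 hlt
        (lt_of_le_of_ne hca (hc a).symm)
  · exact h.elim
  · exact h.elim
  · have hcc : LabelledChain.label i c c' := h
    refine ⟨right_lt_right.2 (lt_of_label hcc), ?_⟩
    rintro (b | ⟨c'', hc''⟩) h1 h2
    · obtain ⟨a, hca, hab⟩ := right_le_left.1 h1.le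
      have hlt : fC a < c' := not_le.1 fun hle => (left_lt_right.1 h2 a hle).not_ge hab
      exact (LabelledChain.covBy_of_label hcc).2 (lt_of_le_of_ne hca (hc a).symm) hlt
    · exact (LabelledChain.covBy_of_label hcc).2 (right_lt_right.1 h1) (right_lt_right.1 h2)

/-- The amalgam as a labelled chain. -/
@[reducible]
noncomputable def labelledChain (hB : IsClosedEmbedding fB) (hC : IsClosedEmbedding fC) :
    LabelledChain (Amalgam fB fC) where
  label := Amalgam.label
  covBy_of_label := covBy_of_label hB hC
  label_unique {i j x y} h h' := by
    rcases x with b | ⟨c, hc⟩ <;> rcases y with b' | ⟨c', hc'⟩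
    · exact LabelledChain.label_unique (Q := B) h h'
    · exact h.elim
    · exact h.elim
    · exact LabelledChain.label_unique (Q := C) h h'

open Classical in
/-- The inclusion of `C` into the amalgam. -/
noncomputable def ofRight (c : C) : Amalgam fB fC :=
  if h : ∃ a, fC a = c then left (fB h.choose) else right c (by simpa using h)

theorem ofRight_apply (hC : IsClosedEmbedding fC) (a : A) :
    (ofRight (fC a) : Amalgam fB fC) = left (fB a) := by
  have h : ∃ a', fC a' = fC a := ⟨a, rfl⟩
  rw [ofRight, dif_pos h, hC.strictMono.injective h.choose_spec]

theorem ofRight_eq_right {c : C} (hc : ∀ a, fC a ≠ c) :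
    (ofRight c : Amalgam fB fC) = right c hc :=
  dif_neg (by simpa using hc)

theorem isClosedEmbedding_left (hB : IsClosedEmbedding fB) (hC : IsClosedEmbedding fC) :
    letI := labelledChain hB hC
    IsClosedEmbedding (left : B → Amalgam fB fC) := by
  let := labelledChain hB hC
  refine ⟨fun _ _ h => left_lt_left.2 h, fun h => h, ?_, ?_⟩
  · rintro i p (b | ⟨c, hc⟩) h
    · exact ⟨b, rfl, h⟩
    · exact h.elim
  · rintro i (b | ⟨c, hc⟩) q h
    · exact ⟨b, rfl, h⟩
    · exact h.elim

theorem isClosedEmbedding_ofRight (hB : IsClosedEmbedding fB) (hC : IsClosedEmbedding fC) :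
    letI := labelledChain hB hC
    IsClosedEmbedding (ofRight : C → Amalgam fB fC) := by
  let := labelledChain hB hC
  refine ⟨?_, ?_, ?_, ?_⟩
  · intro c c' h
    by_cases hc : ∃ a, fC a = c <;> by_cases hc' : ∃ a, fC a = c'
    · obtain ⟨a, rfl⟩ := hc
      obtain ⟨a', rfl⟩ := hc'
      rw [ofRight_apply hC, ofRight_apply hC]
      exact left_lt_left.2 (hB.strictMono (hC.strictMono.lt_iff_lt.1 h))
    · obtain ⟨a, rfl⟩ := hc
      rw [ofRight_apply hC, ofRight_eq_right (by simpa using hc')]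
      exact left_lt_right.2 fun a' h' => hB.strictMono (hC.strictMono.lt_iff_lt.1 (h.trans_le h'))
    · obtain ⟨a', rfl⟩ := hc'
      rw [ofRight_apply hC, ofRight_eq_right (by simpa using hc)]
      refine lt_of_le_of_ne (right_le_left.2 ⟨a', h.le, le_rfl⟩) ?_
      simp
    · rw [ofRight_eq_right (by simpa using hc), ofRight_eq_right (by simpa using hc')]
      exact right_lt_right.2 h
  · intro i c c' h
    by_cases hc : ∃ a, fC a = c
    · obtain ⟨a, rfl⟩ := hc
      obtain ⟨a', rfl, ha⟩ := hC.label_right h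
      rw [ofRight_apply hC, ofRight_apply hC]
      exact hB.map_label ha
    · have hc' : ∀ a, fC a ≠ c' := by
        rintro a rfl
        obtain ⟨a', ha', -⟩ := hC.label_left h
        exact hc ⟨a', ha'⟩
      rw [ofRight_eq_right hc', ofRight_eq_right (by simpa using hc)]
      exact h
  · intro i c s h
    by_cases hc : ∃ a, fC a = c
    · obtain ⟨a, rfl⟩ := hc
      rw [ofRight_apply hC] at h
      rcases s with b | ⟨c', hc'⟩
      · obtain ⟨a', rfl, ha⟩ := hB.label_right (s := b) h
        exact ⟨fC a', ofRight_apply hC a', hC.map_label ha⟩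
      · exact h.elim
    · rw [ofRight_eq_right (by simpa using hc)] at h
      rcases s with b | ⟨c', hc'⟩
      · exact h.elim
      · exact ⟨c', ofRight_eq_right hc', h⟩
  · intro i s c h
    by_cases hc : ∃ a, fC a = c
    · obtain ⟨a, rfl⟩ := hc
      rw [ofRight_apply hC] at h
      rcases s with b | ⟨c', hc'⟩
      · obtain ⟨a', rfl, ha⟩ := hB.label_left (s := b) h
        exact ⟨fC a', ofRight_apply hC a', hC.map_label ha⟩
      · exact h.elim
    · rw [ofRight_eq_right (by simpa using hc)] at h
      rcases s with b | ⟨c', hc'⟩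
      · exact h.elim
      · exact ⟨c', ofRight_eq_right hc', h⟩

end Amalgam

/-- Labelled chains have strong amalgamation. -/
theorem exists_amalgam {fB : A → B} {fC : A → C} (hB : IsClosedEmbedding fB)
    (hC : IsClosedEmbedding fC) :
    ∃ (D : Type u) (_ : LabelledChain D) (gB : B → D) (gC : C → D),
      IsClosedEmbedding gB ∧ IsClosedEmbedding gC ∧ (∀ a, gB (fB a) = gC (fC a)) ∧
      ∀ b c, gB b = gC c → ∃ a, fB a = b := by
  refine ⟨Amalgam fB fC, Amalgam.labelledChain hB hC, Amalgam.left, Amalgam.ofRight,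
    Amalgam.isClosedEmbedding_left hB hC, Amalgam.isClosedEmbedding_ofRight hB hC,
    fun a => (Amalgam.ofRight_apply hC a).symm, ?_⟩
  intro b c h
  by_cases hc : ∃ a, fC a = c
  · obtain ⟨a, rfl⟩ := hc
    rw [Amalgam.ofRight_apply hC] at h
    exact ⟨a, (Amalgam.left.inj h).symm⟩
  · rw [Amalgam.ofRight_eq_right (by simpa using hc)] at h
    cases h

end Amalgam

end LabelledChain

/-! ### From labelled chains to residuated chains -/

/-- In a totally ordered conservative groupoid with unit `e`, the residuals of all elements are
determined by the residuals `r x` of `e`. -/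
theorem le_residual_iff {M : Type u} [LinearOrder M] {m : M → M → M} {e : M}
    (hneg : ∀ x y, x ≤ e → y ≤ e → m x y = min x y)
    (hpos : ∀ x y, e ≤ x → e ≤ y → m x y = max x y)
    (hcons : ∀ x y, m x y = x ∨ m x y = y) {r : M → M} (hr : ∀ x y, y ≤ r x ↔ m x y ≤ e)
    (x y z : M) : y ≤ (if x ≤ z then max (r x) z else min (r x) z) ↔ m x y ≤ z := by
  have h1 := hneg x y
  have h2 := hpos x y
  have h3 := hcons x y
  have h4 := hr x y
  clear hneg hpos hcons hr
  split_ifs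
  · rw [le_max_iff]
    grind
  · rw [le_min_iff]
    grind

/-- Two copies of a chain `Q`, one of them reversed, with a unit in between. -/
inductive SignedChain (Q : Type u) : Type u
  | neg (q : Q) : SignedChain Q
  | one : SignedChain Q
  | pos (q : Q) : SignedChain Q

namespace SignedChain

open LabelledChain

section Order

variable {Q : Type u} [LinearOrder Q]

/-- Positive elements are ordered as in `Q`, negative elements in reverse. -/
protected def LE : SignedChain Q → SignedChain Q → Prop
  | neg p, neg q => q ≤ p
  | neg _, _ => True
  | one, neg _ => False
  | one, _ => True
  | pos p, pos q => p ≤ q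
  | pos _, _ => False

open Classical in
noncomputable instance : LinearOrder (SignedChain Q) where
  le := SignedChain.LE
  le_refl x := by cases x <;> simp [SignedChain.LE]
  le_trans x y z := by
    cases x <;> cases y <;> cases z <;> simp only [SignedChain.LE] <;> grind
  le_antisymm x y := by
    cases x <;> cases y <;> simp only [SignedChain.LE] <;> grind
  le_total x y := by
    cases x <;> cases y <;> simp only [SignedChain.LE] <;> grind
  toDecidableLE := Classical.decRel _

@[simp] theorem neg_le_neg {p q : Q} : neg p ≤ neg q ↔ q ≤ p := Iff.rfl
@[simp] theorem pos_le_pos {p q : Q} : pos p ≤ pos q ↔ p ≤ q := Iff.rfl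
@[simp] theorem neg_le_one {p : Q} : neg p ≤ one := trivial
@[simp] theorem neg_le_pos {p q : Q} : neg p ≤ pos q := trivial
@[simp] theorem one_le_pos {p : Q} : one ≤ pos p := trivial
@[simp] theorem not_one_le_neg {p : Q} : ¬ one ≤ neg p := id
@[simp] theorem not_pos_le_neg {p q : Q} : ¬ pos p ≤ neg q := id
@[simp] theorem not_pos_le_one {p : Q} : ¬ pos p ≤ one := id

theorem neg_lt_neg {p q : Q} : neg p < neg q ↔ q < p := by simp [← not_le]
theorem pos_lt_pos {p q : Q} : pos p < pos q ↔ p < q := by simp [← not_le]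
theorem neg_lt_one {p : Q} : neg p < one := by simp [← not_le]
theorem neg_lt_pos {p q : Q} : neg p < pos q := by simp [← not_le]
theorem one_lt_pos {p : Q} : one < pos p := by simp [← not_le]

theorem min_pos_pos (p q : Q) : min (pos p) (pos q) = pos (min p q) :=
  (Monotone.map_min (f := (pos : Q → SignedChain Q)) fun _ _ h => h).symm

theorem min_neg_neg (p q : Q) : min (neg p) (neg q) = neg (max p q) :=
  (Antitone.map_max (f := (neg : Q → SignedChain Q)) fun _ _ h => h).symm

end Order

variable {Q : Type u} [LabelledChain Q]

open Classical in
/-- The product of two elements is the one at the larger depth, where the depths of `neg q` and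
`pos q` are `2 * q + 1` and `2 * q`, except that the depths of `neg p` and `pos q` are identified
if the pair `p ⋖ q` carries a label. The label then decides between a left zero and a right zero
band. -/
protected noncomputable def mul : SignedChain Q → SignedChain Q → SignedChain Q
  | one, y => y
  | x, one => x
  | neg p, neg q => neg (max p q)
  | pos p, pos q => pos (max p q)
  | neg p, pos q => if q ≤ p ∨ label true p q then neg p else pos q
  | pos q, neg p => if q ≤ p ∨ label false p q then neg p else pos q

noncomputable instance : Mul (SignedChain Q) := ⟨SignedChain.mul⟩

instance : One (SignedChain Q) := ⟨one⟩

@[simp] theorem one_eq : (1 : SignedChain Q) = one := rfl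
@[simp] theorem one_mul' (x : SignedChain Q) : one * x = x := by cases x <;> rfl
@[simp] theorem mul_one' (x : SignedChain Q) : x * one = x := by cases x <;> rfl
@[simp] theorem neg_mul_neg (p q : Q) : neg p * neg q = neg (max p q) := rfl
@[simp] theorem pos_mul_pos (p q : Q) : pos p * pos q = pos (max p q) := rfl

open Classical in
theorem neg_mul_pos (p q : Q) :
    neg p * pos q = if q ≤ p ∨ label true p q then neg p else pos q := rfl

open Classical in
theorem pos_mul_neg (p q : Q) :
    pos q * neg p = if q ≤ p ∨ label false p q then neg p else pos q := rfl

/-- The right inverse. -/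
noncomputable def right : SignedChain Q → SignedChain Q
  | neg p => pos (succ true p)
  | one => one
  | pos q => neg (pred false q)

/-- The left inverse. -/
noncomputable def left : SignedChain Q → SignedChain Q
  | neg p => pos (succ false p)
  | one => one
  | pos q => neg (pred true q)

/-- For opposite signs, the condition in the product under which the negative factor wins is exactly
the one in `le_succ_iff` or `pred_le_iff`. -/
theorem le_right_iff (x y : SignedChain Q) : y ≤ right x ↔ x * y ≤ 1 := by
  cases x <;> cases y <;>
    simp [right, le_succ_iff, pred_le_iff, neg_mul_pos, pos_mul_neg] <;> split_ifs <;> simp_all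

theorem le_left_iff (x y : SignedChain Q) : x ≤ left y ↔ x * y ≤ 1 := by
  cases x <;> cases y <;>
    simp [left, le_succ_iff, pred_le_iff, neg_mul_pos, pos_mul_neg] <;> split_ifs <;> simp_all

theorem mul_conservative (x y : SignedChain Q) : x * y = x ∨ x * y = y := by
  cases x <;> cases y <;> simp [neg_mul_pos, pos_mul_neg] <;> grind

theorem mul_eq_min (x y : SignedChain Q) (hx : x ≤ 1) (hy : y ≤ 1) : x * y = min x y := by
  cases x <;> cases y <;> simp_all [min_neg_neg]

theorem mul_eq_max (x y : SignedChain Q) (hx : 1 ≤ x) (hy : 1 ≤ y) : x * y = max x y := by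
  cases x <;> cases y <;> simp_all
  exact Monotone.map_max (f := (pos : Q → SignedChain Q)) fun _ _ h => h

theorem mul_assoc' (x y z : SignedChain Q) : x * y * z = x * (y * z) := by
  have hcov : ∀ {i} {p q : Q}, label i p q → p < q ∧ ∀ s, s ≤ p ∨ q ≤ s := fun h =>
    ⟨lt_of_label h, fun s => (le_or_gt s _).imp id fun hs => not_lt.1 ((covBy_of_label h).2 hs)⟩
  have hdisj : ∀ {p q : Q}, label true p q → ¬ label false p q := fun h h' =>
    Bool.noConfusion (label_unique h h')
  rcases x with a | _ | a <;> rcases y with b | _ | b <;> rcases z with c | _ | c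
  all_goals try simp only [one_mul', mul_one', neg_mul_neg, pos_mul_pos, max_assoc]
  all_goals
    -- The covering property is only needed at the three elements involved, which leaves a finite
    -- case check.
    have hcov : ∀ {i} {p q : Q}, label i p q →
        p < q ∧ (a ≤ p ∨ q ≤ a) ∧ (b ≤ p ∨ q ≤ b) ∧ (c ≤ p ∨ q ≤ c) :=
      fun h => ⟨(hcov h).1, (hcov h).2 a, (hcov h).2 b, (hcov h).2 c⟩
    simp only [neg_mul_pos, pos_mul_neg]
    split_ifs <;> (try simp only [neg_mul_neg, pos_mul_pos, neg_mul_pos, pos_mul_neg]) <;>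
      (try split_ifs) <;> (try simp only [neg.injEq, pos.injEq, reduceCtorEq]) <;> grind

open Classical in
noncomputable instance : ResiduatedLattice (SignedChain Q) where
  mul_assoc := mul_assoc'
  one_mul := one_mul'
  mul_one := mul_one'
  ldiv x z := if x ≤ z then max (right x) z else min (right x) z
  rdiv z y := if y ≤ z then max (left y) z else min (left y) z
  le_ldiv_iff x y z :=
    le_residual_iff mul_eq_min mul_eq_max mul_conservative le_right_iff x y z
  le_rdiv_iff x y z :=
    -- Right division is left division for the opposite product.
    le_residual_iff (m := fun y x : SignedChain Q => x * y) (e := 1)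
      (fun x y hx hy => (mul_eq_min y x hy hx).trans (min_comm _ _))
      (fun x y hx hy => (mul_eq_max y x hy hx).trans (max_comm _ _))
      (fun x y => (mul_conservative y x).symm) (fun y x => le_left_iff x y) y x z

open ResiduatedLattice

theorem rinv_eq (x : SignedChain Q) : rinv x = right x :=
  eq_of_forall_le_iff fun y => (le_ldiv_iff x y 1).trans (le_right_iff x y).symm

theorem linv_eq (x : SignedChain Q) : linv x = left x :=
  eq_of_forall_le_iff fun y => (le_rdiv_iff y x 1).trans (le_left_iff y x).symm

theorem starInv_neg (p : Q) : starInv (neg p) = pos p := by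
  rw [starInv, rinv_eq, linv_eq]
  exact (min_pos_pos _ _).trans (congrArg pos (min_succ_succ (by decide) p))

theorem starInv_one : starInv (one : SignedChain Q) = one := by
  rw [starInv, rinv_eq, linv_eq]
  exact inf_idem _

theorem starInv_pos (q : Q) : starInv (pos q) = neg q := by
  rw [starInv, rinv_eq, linv_eq]
  exact (min_neg_neg _ _).trans (congrArg neg (max_pred_pred (by decide) q))

theorem isStarInvolutiveIdempotentChain :
    IsStarInvolutiveIdempotentChain (SignedChain Q) where
  total := le_total
  idempotent x := (mul_conservative x x).elim id id
  starInv_starInv x := by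
    cases x <;> simp only [starInv_neg, starInv_pos, starInv_one]

end SignedChain

/-! ### Structure of `⋆`-involutive idempotent residuated chains -/

namespace ResiduatedLattice

/-- The right inverse for `i = true` and the left inverse for `i = false`. -/
def inv {α : Type u} [ResiduatedLattice α] (i : Bool) (x : α) : α :=
  bif i then rinv x else linv x

/-- The product for `i = true` and the opposite product for `i = false`. -/
def sidedMul {α : Type u} [ResiduatedLattice α] (i : Bool) (x y : α) : α :=
  bif i then x * y else y * x

section General

variable {α : Type u} [ResiduatedLattice α]

theorem mul_le_mul_of_le {a b c d : α} (hab : a ≤ b) (hcd : c ≤ d) : a * c ≤ b * d :=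
  ((le_rdiv_iff a c (b * c)).1 (hab.trans ((le_rdiv_iff b c (b * c)).2 le_rfl))).trans
    ((le_ldiv_iff b c (b * d)).1 (hcd.trans ((le_ldiv_iff b d (b * d)).2 le_rfl)))

theorem sidedMul_assoc (i : Bool) (x y z : α) :
    sidedMul i (sidedMul i x y) z = sidedMul i x (sidedMul i y z) := by
  cases i
  · exact (mul_assoc z y x).symm
  · exact mul_assoc x y z

theorem le_inv_iff {i : Bool} {x y : α} : y ≤ inv i x ↔ sidedMul i x y ≤ 1 := by
  cases i
  · exact le_rdiv_iff y x 1
  · exact le_ldiv_iff x y 1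

theorem le_inv_not_iff {i : Bool} {x y : α} : x ≤ inv (!i) y ↔ sidedMul i x y ≤ 1 := by
  rw [le_inv_iff]
  cases i <;> rfl

/-- Both sides say that the same product is at most `1`: the two inverses form an antitone Galois
connection. -/
theorem le_inv_comm {i : Bool} {x y : α} : y ≤ inv i x ↔ x ≤ inv (!i) y := by
  rw [le_inv_iff, le_inv_not_iff]

theorem starInv_eq (i : Bool) (x : α) : starInv x = inv i x ⊓ inv (!i) x := by
  cases i
  · rfl
  · exact inf_comm _ _

theorem inv_antitone (i : Bool) : Antitone (inv i : α → α) := fun _ _ h =>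
  le_inv_comm.2 (h.trans (le_inv_comm.1 le_rfl))

theorem starInv_antitone : Antitone (starInv : α → α) := fun x y h => by
  rw [starInv_eq true, starInv_eq true]
  exact inf_le_inf (inv_antitone _ h) (inv_antitone _ h)

theorem inv_one (i : Bool) : inv i (1 : α) = 1 :=
  eq_of_forall_le_iff fun y => by
    rw [le_inv_iff]
    cases i <;> simp [sidedMul]

theorem starInv_one : starInv (1 : α) = 1 := by
  rw [starInv_eq true, inv_one, inv_one, inf_idem]

end General

namespace IsStarInvolutiveIdempotentChain

variable {α : Type u} [ResiduatedLattice α]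

open Classical in
/-- The linear order of a `⋆`-involutive idempotent residuated chain. -/
@[reducible]
noncomputable def linearOrder (K : IsStarInvolutiveIdempotentChain α) : LinearOrder α where
  toPartialOrder := inferInstance
  min := (· ⊓ ·)
  max := (· ⊔ ·)
  le_total := K.total
  toDecidableLE := Classical.decRel _
  min_def x y := by
    split_ifs with h
    · exact inf_eq_left.2 h
    · exact inf_eq_right.2 ((K.total x y).resolve_left h)
  max_def x y := by
    split_ifs with h
    · exact sup_eq_right.2 h
    · exact sup_eq_left.2 ((K.total x y).resolve_left h)

variable (K : IsStarInvolutiveIdempotentChain α)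
include K

theorem lt_of_not_le {x y : α} (h : ¬ x ≤ y) : y < x :=
  lt_of_le_not_ge ((K.total x y).resolve_left h) h

theorem mul_eq_inf {x y : α} (hx : x ≤ 1) (hy : y ≤ 1) : x * y = x ⊓ y := by
  apply le_antisymm
  · exact le_inf ((mul_le_mul_of_le le_rfl hy).trans_eq (mul_one x))
      ((mul_le_mul_of_le hx le_rfl).trans_eq (one_mul y))
  · exact (K.idempotent (x ⊓ y)).symm.trans_le (mul_le_mul_of_le inf_le_left inf_le_right)

theorem mul_eq_sup {x y : α} (hx : 1 ≤ x) (hy : 1 ≤ y) : x * y = x ⊔ y := by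
  apply le_antisymm
  · exact (mul_le_mul_of_le le_sup_left le_sup_right).trans_eq (K.idempotent (x ⊔ y))
  · exact sup_le ((mul_one x).symm.trans_le (mul_le_mul_of_le le_rfl hy))
      ((one_mul y).symm.trans_le (mul_le_mul_of_le hx le_rfl))

/-- Idempotence lets `x * y` absorb another factor `x`. Both are negative, so that product is a meet
and gives `x * y ≤ x`. The next three lemmas vary this argument: the sign of a mixed product decides
its value. -/
theorem mul_eq_left_of_neg {x y : α} (hx : x ≤ 1) (hy : 1 ≤ y) (h : x * y ≤ 1) : x * y = x := by
  have h1 : x * (x * y) = x * y := by rw [← mul_assoc, K.idempotent]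
  rw [K.mul_eq_inf hx h] at h1
  refine le_antisymm (inf_eq_right.1 h1) ?_
  exact (mul_one x).symm.trans_le (mul_le_mul_of_le le_rfl hy)

theorem mul_eq_right_of_neg {x y : α} (hx : x ≤ 1) (hy : 1 ≤ y) (h : 1 ≤ x * y) :
    x * y = y := by
  have h1 : x * y * y = x * y := by rw [mul_assoc, K.idempotent]
  rw [K.mul_eq_sup h hy] at h1
  refine le_antisymm ?_ (sup_eq_left.1 h1)
  exact (mul_le_mul_of_le hx le_rfl).trans_eq (one_mul y)

theorem mul_eq_right_of_pos {x y : α} (hx : 1 ≤ x) (hy : y ≤ 1) (h : x * y ≤ 1) : x * y = y := by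
  have h1 : x * y * y = x * y := by rw [mul_assoc, K.idempotent]
  rw [K.mul_eq_inf h hy] at h1
  refine le_antisymm (inf_eq_left.1 h1) ?_
  exact (one_mul y).symm.trans_le (mul_le_mul_of_le hx le_rfl)

theorem mul_eq_left_of_pos {x y : α} (hx : 1 ≤ x) (hy : y ≤ 1) (h : 1 ≤ x * y) :
    x * y = x := by
  have h1 : x * (x * y) = x * y := by rw [← mul_assoc, K.idempotent]
  rw [K.mul_eq_sup hx h] at h1
  refine le_antisymm ?_ (sup_eq_right.1 h1)
  exact (mul_le_mul_of_le le_rfl hy).trans_eq (mul_one x)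

theorem mul_conservative (x y : α) : x * y = x ∨ x * y = y := by
  rcases K.total x 1 with hx | hx <;> rcases K.total y 1 with hy | hy
  · rw [K.mul_eq_inf hx hy]
    exact (K.total x y).imp inf_eq_left.2 inf_eq_right.2
  · exact (K.total (x * y) 1).imp (K.mul_eq_left_of_neg hx hy) (K.mul_eq_right_of_neg hx hy)
  · exact (K.total (x * y) 1).symm.imp (K.mul_eq_left_of_pos hx hy) (K.mul_eq_right_of_pos hx hy)
  · rw [K.mul_eq_sup hx hy, sup_eq_left, sup_eq_right]
    exact K.total y x

open Classical in
theorem ldiv_eq (x z : α) : ldiv x z = if x ≤ z then rinv x ⊔ z else rinv x ⊓ z :=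
  letI := K.linearOrder
  eq_of_forall_le_iff fun y => (le_ldiv_iff x y z).trans
    (le_residual_iff (m := fun x y : α => x * y) (e := 1) (r := rinv)
      (fun _ _ => K.mul_eq_inf) (fun _ _ => K.mul_eq_sup) K.mul_conservative
      (fun x y => le_ldiv_iff x y 1) x y z).symm

open Classical in
theorem rdiv_eq (z y : α) : rdiv z y = if y ≤ z then linv y ⊔ z else linv y ⊓ z :=
  letI := K.linearOrder
  eq_of_forall_le_iff fun x => (le_rdiv_iff x y z).trans
    (le_residual_iff (m := fun x y : α => y * x) (e := 1) (r := linv)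
      (fun _ _ hx hy => (K.mul_eq_inf hy hx).trans (inf_comm _ _))
      (fun _ _ hx hy => (K.mul_eq_sup hy hx).trans (sup_comm _ _))
      (fun x y => (K.mul_conservative y x).symm)
      (fun y x => le_rdiv_iff x y 1) y x z).symm

theorem sidedMul_eq_sup {i : Bool} {x y : α} (hx : 1 ≤ x) (hy : 1 ≤ y) :
    sidedMul i x y = x ⊔ y := by
  cases i
  · exact (K.mul_eq_sup hy hx).trans (sup_comm _ _)
  · exact K.mul_eq_sup hx hy

theorem sidedMul_conservative (i : Bool) (x y : α) : sidedMul i x y = x ∨ sidedMul i x y = y := by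
  cases i
  · exact (K.mul_conservative y x).symm
  · exact K.mul_conservative x y

theorem sidedMul_eq_left {i : Bool} {x y : α} (hy : 1 < y) (h : sidedMul i x y ≤ 1) :
    sidedMul i x y = x :=
  (K.sidedMul_conservative i x y).resolve_right fun h' => hy.not_ge (h' ▸ h)

theorem sidedMul_eq_right {i : Bool} {x y : α} (hx : 1 < x) (h : sidedMul i x y ≤ 1) :
    sidedMul i x y = y :=
  (K.sidedMul_conservative i x y).resolve_left fun h' => hx.not_ge (h' ▸ h)

theorem starInv_injective : Function.Injective (starInv : α → α) :=
  Function.LeftInverse.injective K.starInv_starInv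

theorem starInv_lt_one {x : α} (hx : 1 < x) : starInv x < 1 :=
  lt_of_le_of_ne ((starInv_antitone hx.le).trans_eq starInv_one) fun h =>
    hx.ne' (K.starInv_injective (h.trans starInv_one.symm))

theorem one_lt_starInv {x : α} (hx : x < 1) : 1 < starInv x :=
  lt_of_le_of_ne (starInv_one.symm.trans_le (starInv_antitone hx.le)) fun h =>
    hx.ne (K.starInv_injective (h.symm.trans starInv_one.symm))

theorem starInv_lt_starInv {x y : α} (h : x < y) : starInv y < starInv x :=
  lt_of_le_of_ne (starInv_antitone h.le) fun h' => h.ne' (K.starInv_injective h')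

theorem starInv_lt_comm {x y : α} (h : starInv x < y) : starInv y < x :=
  (K.starInv_lt_starInv h).trans_eq (K.starInv_starInv x)

/-- A positive element with two different inverses is an inverse of the larger one. -/
theorem inv_not_inv {i : Bool} {y : α} (hy : 1 < y) (h : starInv y < inv i y) :
    inv (!i) (inv i y) = y := by
  let := K.linearOrder
  set x := inv i y with hx
  -- If the product were `x`, then `x` would lie below both inverses of `y`, hence be `y⋆`.
  have hxy : sidedMul i x y = y := by
    refine (K.sidedMul_conservative i x y).resolve_left fun h' => ?_
    have hx1 : x ≤ 1 := by
      refine not_lt.1 fun hlt => ?_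
      have h1 := K.sidedMul_eq_sup (i := i) hlt.le hy.le
      have h2 := le_inv_iff.1 hx.le
      rw [K.sidedMul_eq_sup hy.le hlt.le] at h2
      exact (le_sup_left.trans h2).not_gt hy
    have h1 : x ≤ inv (!i) y := le_inv_not_iff.2 (h'.trans_le hx1)
    rw [starInv_eq i, ← hx, inf_eq_left.2 h1] at h
    exact h.false
  have hle : y ≤ inv (!i) x := le_inv_comm.1 hx.le
  have hz : sidedMul i (inv (!i) x) x = x :=
    K.sidedMul_eq_right (hy.trans_le hle) (le_inv_not_iff.1 le_rfl)
  -- The two bracketings evaluate to `y` and to `inv (!i) x`.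
  have h1 := sidedMul_assoc i (inv (!i) x) x y
  rw [hz, hxy, K.sidedMul_eq_sup (hy.le.trans hle) hy.le, sup_eq_left.2 hle] at h1
  exact h1.symm

/-- There is at most one element above the smaller and below the larger inverse of a negative
element. -/
theorem eq_of_lt_of_le_inv {i : Bool} {p s : α} (hp : 1 < p) (hps : p < s)
    (hs : s ≤ inv i (starInv p)) : s = inv i (starInv p) := by
  let := K.linearOrder
  set x := starInv p with hx
  set q := inv i x with hq
  -- The meet of the two inverses of `x` is `p`, which is below `s`.
  have hp' : ¬ s ≤ inv (!i) x := fun h => by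
    have h1 := le_inf hs h
    rw [hq, ← starInv_eq, K.starInv_starInv] at h1
    exact h1.not_gt hps
  have hs1 : 1 < s := hp.trans hps
  have hxq : sidedMul i x q = x := K.sidedMul_eq_left (hs1.trans_le hs) (le_inv_iff.1 le_rfl)
  have hsx : sidedMul i s x = s := by
    refine (K.sidedMul_conservative i s x).resolve_right fun h => hp' ?_
    exact le_inv_not_iff.2 (h.trans_le (K.starInv_lt_one hp).le)
  -- The two bracketings evaluate to `q` and to `s`.
  have h1 := sidedMul_assoc i s x q
  rw [hxq, hsx, K.sidedMul_eq_sup hs1.le (hs1.le.trans hs), sup_eq_right.2 hs] at h1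
  exact h1.symm

omit K in
/-- The chain of positive elements, in which `p ⋖ q` is labelled if `q` is an inverse of `p⋆`. -/
@[reducible]
noncomputable def labelledChain (K : IsStarInvolutiveIdempotentChain α) :
    LabelledChain {x : α // 1 < x} :=
  letI := K.linearOrder
  { toLinearOrder := inferInstance
    label := fun i p q => p < q ∧ inv i (starInv p.1) = q.1
    covBy_of_label := fun {i p q} h => ⟨h.1, fun s hps hsq => by
      refine hsq.ne (Subtype.ext ?_)
      rw [← h.2]
      exact K.eq_of_lt_of_le_inv p.2 hps ((show s.1 ≤ q.1 from hsq.le).trans_eq h.2.symm)⟩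
    label_unique := fun {i j p q} h h' => by
      by_contra hij
      have hj : j = !i := by cases i <;> cases j <;> simp_all
      subst hj
      -- If both inverses of `p⋆` were `q`, then `p⋆⋆` would be `q` instead of `p`.
      have h1 := K.starInv_starInv p.1
      rw [starInv_eq i, h.2, h'.2, inf_idem] at h1
      exact h.1.ne' (Subtype.ext h1) }

end IsStarInvolutiveIdempotentChain

end ResiduatedLattice

/-! ### Chains as signed chains over their positive elements -/

namespace SignedChain

variable {Q : Type u} [LabelledChain Q]

open LabelledChain ResiduatedLattice

theorem inv_neg (i : Bool) (p : Q) : inv i (neg p) = pos (succ i p) := by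
  cases i
  · exact linv_eq _
  · exact rinv_eq _

theorem inv_pos (i : Bool) (q : Q) : inv i (pos q) = neg (pred (!i) q) := by
  cases i
  · exact linv_eq _
  · exact rinv_eq _

end SignedChain

namespace ResiduatedLattice

open LabelledChain

namespace IsStarInvolutiveIdempotentChain

variable {α : Type u} [ResiduatedLattice α] (K : IsStarInvolutiveIdempotentChain α)
include K

theorem eq_one_or_exists (x : α) :
    x = 1 ∨ (∃ p : {x : α // 1 < x}, x = p) ∨ ∃ p : {x : α // 1 < x}, x = starInv p.1 := by
  let := K.linearOrder
  rcases lt_trichotomy x 1 with h | h | h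
  · exact Or.inr (Or.inr ⟨⟨starInv x, K.one_lt_starInv h⟩, (K.starInv_starInv x).symm⟩)
  · exact Or.inl h
  · exact Or.inr (Or.inl ⟨⟨x, h⟩, rfl⟩)

theorem inv_starInv (i : Bool) (p : {x : α // 1 < x}) :
    letI := K.labelledChain
    inv i (starInv p.1) = (succ i p).1 := by
  let := K.labelledChain
  have hle : p.1 ≤ inv i (starInv p.1) := by
    conv_lhs => rw [← K.starInv_starInv p.1, starInv_eq i]
    exact inf_le_left
  rcases hle.eq_or_lt with h | h
  · rw [succ_eq_self, ← h]
    exact fun q hq => hq.1.ne (Subtype.ext (h.trans hq.2))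
  · have hq : label i p ⟨inv i (starInv p.1), p.2.trans h⟩ := ⟨h, rfl⟩
    rw [succ_eq_of_label hq]

/-- The side flips because the inverses are adjoint to each other. If `inv i q` differs from `q⋆`,
then `inv_not_inv` recovers `q` from it, which is the label required. -/
theorem inv_coe (i : Bool) (q : {x : α // 1 < x}) :
    letI := K.labelledChain
    inv i q.1 = starInv (pred (!i) q).1 := by
  let := K.labelledChain
  have hle : starInv q.1 ≤ inv i q.1 := by
    rw [starInv_eq i]
    exact inf_le_left
  rcases hle.eq_or_lt with h | h
  · rw [pred_eq_self, ← h]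
    intro p hp
    have h1 : starInv p.1 ≤ inv i q.1 := le_inv_comm.2 hp.2.ge
    rw [← h] at h1
    exact (K.starInv_lt_starInv (show p.1 < q.1 from hp.1)).not_ge h1
  · have hlt : inv i q.1 < 1 := by
      refine K.lt_of_not_le fun h1 => ?_
      have h2 := le_inv_comm.1 h1
      rw [inv_one] at h2
      exact h2.not_gt q.2
    have hp : label (!i) ⟨starInv (inv i q.1), K.one_lt_starInv hlt⟩ q := by
      refine ⟨K.starInv_lt_comm h, ?_⟩
      change inv (!i) (starInv (starInv (inv i q.1))) = q.1
      rw [K.starInv_starInv]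
      exact K.inv_not_inv q.2 h
    rw [pred_eq_of_label hp, K.starInv_starInv]

section ToSignedChain

variable {Q : Type v} (f : {x : α // 1 < x} → Q)

open Classical in
omit K in
/-- The extension of a map on positive elements to all elements. -/
noncomputable def toSignedChain (K : IsStarInvolutiveIdempotentChain α)
    (f : {x : α // 1 < x} → Q) (x : α) : SignedChain Q :=
  if h : 1 < x then .pos (f ⟨x, h⟩)
  else if h : x < 1 then .neg (f ⟨starInv x, K.one_lt_starInv h⟩)
  else .one

theorem toSignedChain_coe (p : {x : α // 1 < x}) : K.toSignedChain f p.1 = .pos (f p) :=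
  dif_pos p.2

theorem toSignedChain_one : K.toSignedChain f 1 = .one := by
  simp [toSignedChain]

theorem toSignedChain_starInv (p : {x : α // 1 < x}) :
    K.toSignedChain f (starInv p.1) = .neg (f p) := by
  have h := K.starInv_lt_one p.2
  rw [toSignedChain, dif_neg h.not_gt, dif_pos h]
  simp only [K.starInv_starInv]

end ToSignedChain

omit K in
/-- A map that preserves the order, the unit and the inverses is an embedding. -/
theorem isEmbedding_of_strictMono {β : Type v} [ResiduatedLattice β]
    (K : IsStarInvolutiveIdempotentChain α) (K' : IsStarInvolutiveIdempotentChain β) {f : α → β}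
    (hf : StrictMono f) (h1 : f 1 = 1) (hinv : ∀ i x, f (inv i x) = inv i (f x)) :
    IsEmbedding f := by
  let := K.linearOrder
  let := K'.linearOrder
  have hle : ∀ {x y}, f x ≤ f y ↔ x ≤ y := hf.le_iff_le
  have hle1 : ∀ {x}, f x ≤ 1 ↔ x ≤ 1 := fun {x} => by rw [← h1, hle]
  have h1le : ∀ {x}, 1 ≤ f x ↔ 1 ≤ x := fun {x} => by rw [← h1, hle]
  have hinf : ∀ x y, f (x ⊓ y) = f x ⊓ f y := fun x y => hf.monotone.map_min
  have hsup : ∀ x y, f (x ⊔ y) = f x ⊔ f y := fun x y => hf.monotone.map_max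
  have hr : ∀ x, f (rinv x) = rinv (f x) := hinv true
  have hl : ∀ x, f (linv x) = linv (f x) := hinv false
  -- By residuation, the sign of a product is visible from order and inverses alone; this settles
  -- factors of opposite sign.
  have hmul1 : ∀ {x y}, f x * f y ≤ 1 ↔ x * y ≤ 1 := fun {x y} =>
    (le_ldiv_iff (f x) (f y) 1).symm.trans <| by
      rw [← le_ldiv_iff]
      exact (iff_of_eq (congrArg (f y ≤ ·) (hr x).symm)).trans hle
  refine ⟨hf.injective, hinf, hsup, ?_, ?_, ?_, h1⟩
  · intro x y
    rcases le_total x 1 with hx | hx <;> rcases le_total y 1 with hy | hy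
    · rw [K.mul_eq_inf hx hy, K'.mul_eq_inf (hle1.2 hx) (hle1.2 hy), hinf]
    · by_cases h : x * y ≤ 1
      · rw [K.mul_eq_left_of_neg hx hy h,
          K'.mul_eq_left_of_neg (hle1.2 hx) (h1le.2 hy) (hmul1.2 h)]
      · rw [K.mul_eq_right_of_neg hx hy (le_of_not_ge h),
          K'.mul_eq_right_of_neg (hle1.2 hx) (h1le.2 hy) (le_of_not_ge (mt hmul1.1 h))]
    · by_cases h : x * y ≤ 1
      · rw [K.mul_eq_right_of_pos hx hy h,
          K'.mul_eq_right_of_pos (h1le.2 hx) (hle1.2 hy) (hmul1.2 h)]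
      · rw [K.mul_eq_left_of_pos hx hy (le_of_not_ge h),
          K'.mul_eq_left_of_pos (h1le.2 hx) (hle1.2 hy) (le_of_not_ge (mt hmul1.1 h))]
    · rw [K.mul_eq_sup hx hy, K'.mul_eq_sup (h1le.2 hx) (h1le.2 hy), hsup]
  · intro x z
    rw [K.ldiv_eq, K'.ldiv_eq, apply_ite f, hinf, hsup, hr]
    simp only [hle]
  · intro z y
    rw [K.rdiv_eq, K'.rdiv_eq, apply_ite f, hinf, hsup, hl]
    simp only [hle]

/-- Allowing an arbitrary target `Q` lets this serve directly for the maps into the amalgam. -/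
theorem isEmbedding_toSignedChain {Q : Type v} [LabelledChain Q] {f : {x : α // 1 < x} → Q}
    (hf : letI := K.labelledChain; IsClosedEmbedding f) : IsEmbedding (K.toSignedChain f) := by
  let := K.labelledChain
  refine K.isEmbedding_of_strictMono SignedChain.isStarInvolutiveIdempotentChain ?_
    (K.toSignedChain_one f) ?_
  · intro x y h
    rcases K.eq_one_or_exists x with rfl | ⟨p, rfl⟩ | ⟨p, rfl⟩ <;>
      rcases K.eq_one_or_exists y with rfl | ⟨q, rfl⟩ | ⟨q, rfl⟩ <;>
      simp only [K.toSignedChain_one, K.toSignedChain_coe, K.toSignedChain_starInv]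
    · exact h.false.elim
    · exact SignedChain.one_lt_pos
    · exact ((K.starInv_lt_one q.2).asymm h).elim
    · exact (p.2.asymm h).elim
    · exact SignedChain.pos_lt_pos.2 (hf.strictMono h)
    · exact (((K.starInv_lt_one q.2).trans p.2).asymm h).elim
    · exact SignedChain.neg_lt_one
    · exact SignedChain.neg_lt_pos
    · have hqp := K.starInv_lt_starInv h
      rw [K.starInv_starInv, K.starInv_starInv] at hqp
      exact SignedChain.neg_lt_neg.2 (hf.strictMono hqp)
  · intro i x
    rcases K.eq_one_or_exists x with rfl | ⟨p, rfl⟩ | ⟨p, rfl⟩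
    · rw [inv_one, K.toSignedChain_one]
      exact (inv_one i).symm
    · rw [K.inv_coe, K.toSignedChain_starInv, K.toSignedChain_coe, SignedChain.inv_pos,
        hf.map_pred]
    · rw [K.inv_starInv, K.toSignedChain_coe, K.toSignedChain_starInv, SignedChain.inv_neg,
        hf.map_succ]

end IsStarInvolutiveIdempotentChain

/-! ### Embeddings restrict to closed embeddings of positive elements -/

namespace IsEmbedding

variable {α : Type u} {β : Type v} [ResiduatedLattice α] [ResiduatedLattice β] {f : α → β}

theorem strictMono (hf : IsEmbedding f) : StrictMono f :=
  Monotone.strictMono_of_injective (fun x y h => by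
    rw [← inf_eq_left, ← hf.map_inf, inf_eq_left.2 h]) hf.injective

theorem map_inv (hf : IsEmbedding f) (i : Bool) (x : α) : f (inv i x) = inv i (f x) := by
  cases i
  · exact (hf.map_rdiv 1 x).trans (congrArg (rdiv · (f x)) hf.map_one)
  · exact (hf.map_ldiv x 1).trans (congrArg (ldiv (f x)) hf.map_one)

theorem map_starInv (hf : IsEmbedding f) (x : α) : f (starInv x) = starInv (f x) := by
  rw [starInv_eq true, starInv_eq true, hf.map_inf, hf.map_inv, hf.map_inv]

/-- The restriction of an embedding to the positive elements. -/
def mapPos (hf : IsEmbedding f) (p : {x : α // 1 < x}) : {y : β // 1 < y} :=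
  ⟨f p.1, hf.map_one.symm.trans_lt (hf.strictMono p.2)⟩

theorem one_lt_iff (hf : IsEmbedding f) (K : IsStarInvolutiveIdempotentChain α) {x : α} :
    1 < f x ↔ 1 < x := by
  let := K.linearOrder
  rw [← hf.map_one]
  exact hf.strictMono.lt_iff_lt

theorem isClosedEmbedding_mapPos (hf : IsEmbedding f) (K : IsStarInvolutiveIdempotentChain α)
    (K' : IsStarInvolutiveIdempotentChain β) :
    letI := K.labelledChain
    letI := K'.labelledChain
    IsClosedEmbedding hf.mapPos := by
  let := K.labelledChain
  let := K'.labelledChain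
  have hlt : ∀ {p q}, hf.mapPos p < hf.mapPos q ↔ p < q := fun {p q} =>
    letI := K.linearOrder
    hf.strictMono.lt_iff_lt (a := p.1) (b := q.1)
  refine ⟨fun _ _ h => hlt.2 h, ?_, ?_, ?_⟩
  · intro i p q h
    refine ⟨hlt.2 h.1, ?_⟩
    change inv i (starInv (f p.1)) = f q.1
    rw [← hf.map_starInv, ← hf.map_inv, h.2]
  · intro i p s h
    have hs : f (inv i (starInv p.1)) = s.1 := by
      rw [hf.map_inv, hf.map_starInv]
      exact h.2
    have h1 : 1 < inv i (starInv p.1) := (hf.one_lt_iff K).1 (s.2.trans_eq hs.symm)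
    have hq : hf.mapPos ⟨_, h1⟩ = s := Subtype.ext hs
    exact ⟨⟨_, h1⟩, hq, hlt.1 (hq ▸ h.1), rfl⟩
  · intro i s q h
    -- The lower neighbour is a term in `q`: its star is `inv (!i) q`, and `f` preserves this.
    have hpred : hf.mapPos (pred i q) = s := by
      refine Subtype.ext (K'.starInv_injective ?_)
      have h1 := K.inv_coe (!i) q
      have h2 := K'.inv_coe (!i) (hf.mapPos q)
      rw [Bool.not_not] at h1 h2
      rw [pred_eq_of_label h] at h2
      rw [← h2]
      change starInv (f (pred i q).1) = inv (!i) (f q.1)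
      rw [← hf.map_starInv, ← hf.map_inv, h1]
    refine ⟨pred i q, hpred, ?_⟩
    have hlt' : pred i q < q := hlt.1 (hpred ▸ h.1)
    exact (pred_le_iff.1 le_rfl).resolve_left hlt'.not_ge

end IsEmbedding

end ResiduatedLattice

/-! ### Assembling the strong amalgam -/

theorem theoremt :
    ResiduatedLattice.HasStrongAmalgamationProperty.{u}
      (fun (α : Type u) [ResiduatedLattice α] =>
        ResiduatedLattice.IsStarInvolutiveIdempotentChain α) := by
  intro A B C _ _ _ KA KB KC fB fC hB hC
  let := KA.labelledChain
  let := KB.labelledChain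
  let := KC.labelledChain
  obtain ⟨D, _, gB, gC, hgB, hgC, hcomm, hstrong⟩ := LabelledChain.exists_amalgam
    (hB.isClosedEmbedding_mapPos KA KB) (hC.isClosedEmbedding_mapPos KA KC)
  have hcomm' : KB.toSignedChain gB ∘ fB = KC.toSignedChain gC ∘ fC := by
    funext x
    simp only [Function.comp_apply]
    rcases KA.eq_one_or_exists x with rfl | ⟨p, rfl⟩ | ⟨p, rfl⟩
    · rw [hB.map_one, hC.map_one, KB.toSignedChain_one, KC.toSignedChain_one]
    · exact (KB.toSignedChain_coe gB (hB.mapPos p)).trans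
        ((congrArg SignedChain.pos (hcomm p)).trans (KC.toSignedChain_coe gC (hC.mapPos p)).symm)
    · rw [hB.map_starInv, hC.map_starInv]
      exact (KB.toSignedChain_starInv gB (hB.mapPos p)).trans
        ((congrArg SignedChain.neg (hcomm p)).trans
          (KC.toSignedChain_starInv gC (hC.mapPos p)).symm)
  refine ⟨SignedChain D, inferInstance, KB.toSignedChain gB, KC.toSignedChain gC,
    SignedChain.isStarInvolutiveIdempotentChain, KB.isEmbedding_toSignedChain hgB,
    KC.isEmbedding_toSignedChain hgC, hcomm', Set.Subset.antisymm ?_ ?_⟩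
  · rintro _ ⟨a, rfl⟩
    exact ⟨⟨fB a, rfl⟩, ⟨fC a, (congrFun hcomm' a).symm⟩⟩
  · rintro _ ⟨⟨b, rfl⟩, c, hbc⟩
    suffices h : ∃ a, fB a = b by
      obtain ⟨a, rfl⟩ := h
      exact ⟨a, rfl⟩
    -- Elements with equal images have the same sign, so strongness reduces to that of the amalgam
    -- of positive elements.
    rcases KB.eq_one_or_exists b with rfl | ⟨p, rfl⟩ | ⟨p, rfl⟩ <;>
      rcases KC.eq_one_or_exists c with rfl | ⟨q, rfl⟩ | ⟨q, rfl⟩ <;>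
      simp only [KB.toSignedChain_one, KB.toSignedChain_coe, KB.toSignedChain_starInv,
        KC.toSignedChain_one, KC.toSignedChain_coe, KC.toSignedChain_starInv, reduceCtorEq,
        SignedChain.pos.injEq, SignedChain.neg.injEq] at hbc
    · exact ⟨1, hB.map_one⟩
    · obtain ⟨a, rfl⟩ := hstrong p q hbc.symm
      exact ⟨a, rfl⟩
    · obtain ⟨a, rfl⟩ := hstrong p q hbc.symm
      exact ⟨ResiduatedLattice.starInv a, hB.map_starInv a⟩
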